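/- For a probability distribution $F$ on $\mathbb R$ with finite moments of all orders, let $\mu$ be its mean and $\mu_j=\mathbb E(X-\mu)^j$, $X\sim F$, its central moments. For an i.i.d. sample $X_1,\dots,X_n$ from $F$ put $\bar X_n=\frac1n\sum_{i=1}^n X_i$ and $M_{j,n}=\frac1n\sum_{i=1}^n (X_i-\bar X_n)^j$. For $k\ge 2$, $\bar X_n$ is called asymptotically independent of $(M_{2,n},\dots,M_{k,n})$ if there are random variables $W_1,\dots,W_k$, with $W_1$ independent of the vector $(W_2,\dots,W_k)$, such that, as $n\to\infty$, $$\sqrt n\,\bigl(\bar X_n-\mu,\;M_{2,n}-\mu_2,\dots,M_{k,n}-\mu_k\bigr)\xrightarrow{\;d\;}(W_1,W_2,\dots,W_k).$$ **Theorem.** For every fixed $k\ge 2$ there are infinitely many non-degenerate, non-normal probability distributions $F$ on $\mathbb R$ with finite moments of all orders for which $\bar X_n$ is asymptotically independent of $(M_{2,n},\dots,M_{k,n})$. More precisely, let $\phi$ be the standard normal density and $P_m(x)=\frac{d^m}{dx^m}\bigl[x^m(1-x)^m\bigr]$ the (unnormalised) shifted Legendre polynomial of degree $m$. For every $m\ge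 k+2$ there is $\epsilon_m>0$ with $\phi+\epsilon_m P_m>0$ on $[0,1]$. For every such $m$ and $\epsilon_m$ the function $$f_m(x)=\phi(x)+\epsilon_m P_m(x)\,\mathbf 1_{[0,1]}(x),\qquad x\in\mathbb R,$$ is the density of a probability distribution which has all the properties above, and different values of $m$ give different distributions. -/

import Mathlib

open MeasureTheory ProbabilityTheory Filter Set
open scoped Topology Polynomial

universe u

noncomputable section

namespace SampleMoments

/-- The sample mean `X̄_n = (1/n) ∑ X_i` of the first `n` terms of the sequence `X`
(the sample is indexed by `0, …, n - 1`). -/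
def sampleMean {Ω : Type u} (X : ℕ → Ω → ℝ) (n : ℕ) (ω : Ω) : ℝ :=
  (1 / (n : ℝ)) * ∑ i ∈ Finset.range n, X i ω

/-- The `j`-th sample central moment `M_{j,n} = (1/n) ∑ (X_i - X̄_n)^j`. -/
def sampleCentralMoment {Ω : Type u} (X : ℕ → Ω → ℝ) (j n : ℕ) (ω : Ω) : ℝ :=
  (1 / (n : ℝ)) * ∑ i ∈ Finset.range n, (X i ω - sampleMean X n ω) ^ j

/-- The vector `√n (X̄_n - μ, (M_{2,n}, …, M_{k,n}) - (μ_2, …, μ_k))`, where `μ` is the mean of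
`F` and `μ_j` is the `j`-th central moment of `F`. -/
def scaledDeviation (F : Measure ℝ) {Ω : Type u} (X : ℕ → Ω → ℝ) (k n : ℕ) (ω : Ω) :
    ℝ × (Finset.Icc 2 k → ℝ) :=
  (√(n : ℝ) * (sampleMean X n ω - ∫ x, x ∂F),
    fun j => √(n : ℝ) *
      (sampleCentralMoment X (j : ℕ) n ω - centralMoment (fun x : ℝ => x) (j : ℕ) F))

/-- The sample mean is asymptotically independent of the vector `(M_{2,n}, …, M_{k,n})` when
sampling from `F`: for i.i.d. `X_0, X_1, …` with law `F`, on whatever probability space, there are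
independent `W₁` and `W'` such that
`√n (X̄_n - μ, (M_{2,n}, …, M_{k,n}) - (μ_2, …, μ_k))` converges in distribution to `(W₁, W')`. -/
def IsAsymptoticallyIndependent (F : Measure ℝ) (k : ℕ) : Prop :=
  ∀ (Ω : Type u) (_ : MeasurableSpace Ω) (P : Measure Ω) (_ : IsProbabilityMeasure P)
    (X : ℕ → Ω → ℝ), iIndepFun X P → (∀ i, HasLaw (X i) F P) →
    ∃ (Ω' : Type) (_ : MeasurableSpace Ω') (Q : Measure Ω') (_ : IsProbabilityMeasure Q)
      (W₁ : Ω' → ℝ) (W' : Ω' → (Finset.Icc 2 k → ℝ)),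
      IndepFun W₁ W' Q ∧
      TendstoInDistribution (fun n : ℕ => scaledDeviation F X k n) atTop
        (fun ω => (W₁ ω, W' ω)) (fun _ => P) Q

/-- The set of points of increase of the distribution function of `F`. -/
def pointsOfIncrease (F : Measure ℝ) : Set ℝ :=
  {x | ∀ ε > 0, 0 < cdf F (x + ε) - cdf F (x - ε)}

/-- `F` is a non-degenerate, non-normal probability distribution with finite moments of any order
such that the sample mean is asymptotically independent of `(M_{2,n}, …, M_{k,n})`. -/
structure IsNonNormalWithAsymptoticIndependence (k : ℕ) (F : Measure ℝ) : Prop where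
  isProbabilityMeasure : IsProbabilityMeasure F
  nondegenerate : (pointsOfIncrease F).Nontrivial
  not_normal : ∀ m v, F ≠ gaussianReal m v
  finite_moments : ∀ j : ℕ, Integrable (fun x : ℝ => |x| ^ j) F
  asymptotically_independent : IsAsymptoticallyIndependent.{u} F k

/-- The (unnormalised) shifted Legendre polynomial `P_m = (d/dx)^m [x^m (1 - x)^m]`. -/
def legendreP (m : ℕ) : ℝ[X] :=
  Polynomial.derivative^[m] (Polynomial.X ^ m * (1 - Polynomial.X) ^ m)

/-- The function `φ + ε P_m 1_{[0,1]}`, where `φ` is the standard normal density. -/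
def perturbedDensity (m : ℕ) (ε : ℝ) (x : ℝ) : ℝ :=
  gaussianPDFReal 0 1 x + ε * (Icc (0 : ℝ) 1).indicator (fun y => (legendreP m).eval y) x

/-- The measure on `ℝ` with density `φ + ε P_m 1_{[0,1]}` with respect to Lebesgue measure. -/
def perturbedNormal (m : ℕ) (ε : ℝ) : Measure ℝ :=
  volume.withDensity (fun x => ENNReal.ofReal (perturbedDensity m ε x))

/-- `ε` is positive and so small that `φ + ε P_m` is positive on `[0,1]`. -/
def IsAdmissible (m : ℕ) (ε : ℝ) : Prop :=
  0 < ε ∧ ∀ x ∈ Icc (0 : ℝ) 1, 0 < gaussianPDFReal 0 1 x + ε * (legendreP m).eval x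

end SampleMoments

end

/-! Let F have mean 0, and let S_j be the centred sums of X_i^j divided by √n. Expanding M_{j,n}
binomially gives √n (M_{j,n} - μ_j) = S_j + S_1 R_j, where R_j → -j μ_{j-1} almost surely by the
strong law. The multivariate CLT and Slutsky's theorem then give the limit (Z_1, (Z_j - j μ_{j-1}
Z_1)_j) with Z Gaussian. For jointly Gaussian vectors independence means zero covariance, that is,
μ_{j+1} = j μ_{j-1} μ_2 for 2 ≤ j ≤ k (`isAsymptoticallyIndependent_of_moments`).

The standard normal law satisfies this recursion, which involves only moments of order at most k +
1. Since P_m is orthogonal on [0,1] to all polynomials of degree < m, adding ε P_m changes no moment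
of order below m. It does change the m-th, which rules out normality and separates different m. -/

namespace SampleMoments

/-! ### Orthogonality of shifted Legendre polynomials -/

section Legendre

lemma eval_iterate_derivative_bernstein_eq_zero {m i : ℕ} (hi : i < m) {c : ℝ}
    (hc : c = 0 ∨ c = 1) :
    (Polynomial.derivative^[i] (Polynomial.X ^ m * (1 - Polynomial.X) ^ m : ℝ[X])).eval c = 0 := by
  have key : ∀ q : ℝ[X], q ^ m ∣ (Polynomial.X ^ m * (1 - Polynomial.X) ^ m : ℝ[X]) →
      q.eval c = 0 →
      (Polynomial.derivative^[i] (Polynomial.X ^ m * (1 - Polynomial.X) ^ m : ℝ[X])).eval c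
        = 0 := by
    intro q hq hqc
    obtain ⟨r, hr⟩ := Polynomial.pow_sub_dvd_iterate_derivative_of_pow_dvd i hq
    rw [hr, Polynomial.eval_mul, Polynomial.eval_pow, hqc, zero_pow (by lia), zero_mul]
  rcases hc with rfl | rfl
  · exact key Polynomial.X (dvd_mul_right _ _) (by simp)
  · exact key (1 - Polynomial.X) (dvd_mul_left _ _) (by simp)

lemma integral_mul_derivative_of_eval_eq_zero (q p : ℝ[X]) (h0 : p.eval 0 = 0)
    (h1 : p.eval 1 = 0) :
    ∫ x in (0 : ℝ)..1, q.eval x * p.derivative.eval x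
      = -∫ x in (0 : ℝ)..1, q.derivative.eval x * p.eval x := by
  rw [intervalIntegral.integral_mul_deriv_eq_deriv_mul (u := fun x => q.eval x)
    (v := fun x => p.eval x) (u' := fun x => q.derivative.eval x)
    (v' := fun x => p.derivative.eval x) (fun x _ => q.hasDerivAt x) (fun x _ => p.hasDerivAt x)
    (q.derivative.continuous.intervalIntegrable _ _)
    (p.derivative.continuous.intervalIntegrable _ _)]
  simp [h0, h1]

/-- Integrate by parts m times; 0 and 1 are roots of order m of x^m (1 - x)^m, so all boundary terms
vanish. -/
lemma integral_mul_legendreP (m : ℕ) (q : ℝ[X]) :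
    ∫ x in (0 : ℝ)..1, q.eval x * (legendreP m).eval x
      = (-1) ^ m * ∫ x in (0 : ℝ)..1,
        (Polynomial.derivative^[m] q).eval x * (x ^ m * (1 - x) ^ m) := by
  have key : ∀ i ≤ m, ∀ q : ℝ[X], ∫ x in (0 : ℝ)..1, q.eval x *
      (Polynomial.derivative^[i] (Polynomial.X ^ m * (1 - Polynomial.X) ^ m : ℝ[X])).eval x
      = (-1) ^ i * ∫ x in (0 : ℝ)..1,
        (Polynomial.derivative^[i] q).eval x * (x ^ m * (1 - x) ^ m) := by
    intro i
    induction i with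
    | zero => intro _ q; simp
    | succ i ih =>
      intro hi q
      rw [Function.iterate_succ_apply', integral_mul_derivative_of_eval_eq_zero _ _
        (eval_iterate_derivative_bernstein_eq_zero hi (.inl rfl))
        (eval_iterate_derivative_bernstein_eq_zero hi (.inr rfl)), ih (by lia),
        Function.iterate_succ_apply]
      ring
  exact key m le_rfl q

lemma integral_pow_mul_legendreP_of_lt {m j : ℕ} (h : j < m) :
    ∫ x in (0 : ℝ)..1, x ^ j * (legendreP m).eval x = 0 := by
  have := integral_mul_legendreP m (Polynomial.X ^ j)
  rw [Polynomial.iterate_derivative_eq_zero (by simpa using h)] at this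
  simpa using this

/-- The m-th derivative of x^m is m!, which leaves (-1)^m m! times a positive Beta integral. -/
lemma integral_pow_mul_legendreP_self_ne_zero (m : ℕ) :
    ∫ x in (0 : ℝ)..1, x ^ m * (legendreP m).eval x ≠ 0 := by
  have := integral_mul_legendreP m (Polynomial.X ^ m)
  simp only [Polynomial.eval_pow, Polynomial.eval_X] at this
  rw [this, Polynomial.iterate_derivative_X_pow_eq_natCast_mul]
  have hpos : 0 < ∫ x in (0 : ℝ)..1, x ^ m * (1 - x) ^ m := by
    refine intervalIntegral.intervalIntegral_pos_of_pos_on ?_ ?_ one_pos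
    · exact Continuous.intervalIntegrable (by fun_prop) _ _
    · intro x hx
      have := hx.1
      have := sub_pos.2 hx.2
      positivity
  simp [Nat.descFactorial_self, Nat.factorial_ne_zero, hpos.ne']

end Legendre

/-! ### Moments of the standard normal law -/

section GaussianMoments

lemma integrable_pow_gaussianReal (j : ℕ) :
    Integrable (fun x : ℝ => x ^ j) (gaussianReal 0 1) := by
  have := (memLp_id_gaussianReal' (μ := 0) (v := 1) j (by simp)).integrable_norm_pow'
  refine (integrable_norm_iff (by fun_prop)).1 ?_
  simpa using this

lemma integrable_gaussianPDFReal_mul_pow (j : ℕ) :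
    Integrable (fun x : ℝ => gaussianPDFReal 0 1 x * x ^ j) := by
  have h := integrable_pow_gaussianReal j
  rw [gaussianReal_of_var_ne_zero _ one_ne_zero, integrable_withDensity_iff_integrable_smul'
    (measurable_gaussianPDF _ _) (by simp [gaussianPDF])] at h
  simpa [toReal_gaussianPDF] using h

lemma hasDerivAt_gaussianPDFReal (x : ℝ) :
    HasDerivAt (gaussianPDFReal 0 1) (-(x * gaussianPDFReal 0 1 x)) x := by
  unfold gaussianPDFReal
  have h : HasDerivAt (fun y : ℝ => -(y - 0) ^ 2 / (2 * ((1 : NNReal) : ℝ))) (-x) x := by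
    have := (((hasDerivAt_id x).sub_const 0).pow 2).neg.div_const (2 * ((1 : NNReal) : ℝ))
    refine this.congr_deriv ?_
    simp only [id_eq, NNReal.coe_one]
    ring
  refine (h.exp.const_mul _).congr_deriv ?_
  ring

/-- Integration by parts with φ' = -x φ. At j = 0 the truncated exponent is harmless, because of the
factor j. -/
lemma integral_pow_succ_gaussianReal (j : ℕ) :
    ∫ x, x ^ (j + 1) ∂(gaussianReal 0 1) = j * ∫ x, x ^ (j - 1) ∂(gaussianReal 0 1) := by
  simp_rw [integral_gaussianReal_eq_integral_smul one_ne_zero, smul_eq_mul]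
  have h := integral_mul_deriv_eq_deriv_mul_of_integrable (u := fun x : ℝ => x ^ j)
    (v := gaussianPDFReal 0 1) (u' := fun x => j * x ^ (j - 1))
    (v' := fun x => -(x * gaussianPDFReal 0 1 x)) (fun x _ => hasDerivAt_pow j x)
    (fun x _ => hasDerivAt_gaussianPDFReal x) ?_ ?_ ?_
  · rw [← integral_const_mul]
    rw [← neg_inj, ← integral_neg, ← integral_neg]
    rw [← integral_neg] at h
    convert! h using 3 <;> ring
  · convert! (integrable_gaussianPDFReal_mul_pow (j + 1)).neg using 1
    ext x; simp; ring
  · convert! (integrable_gaussianPDFReal_mul_pow (j - 1)).const_mul (j : ℝ) using 1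
    ext x; simp; ring
  · convert! integrable_gaussianPDFReal_mul_pow j using 1
    ext x; simp; ring

end GaussianMoments

/-! ### The perturbed normal law and its moments -/

section PerturbedNormal

variable {m : ℕ} {ε : ℝ}

lemma exists_isAdmissible (m : ℕ) : ∃ ε : ℝ, IsAdmissible m ε := by
  obtain ⟨C, hC⟩ := isCompact_Icc.exists_bound_of_continuousOn (s := Icc (0 : ℝ) 1)
    (f := fun x => (legendreP m).eval x) (legendreP m).continuous.continuousOn
  obtain ⟨x₀, -, hx₀⟩ := isCompact_Icc.exists_isMinOn (s := Icc (0 : ℝ) 1) ⟨0, by simp⟩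
    (f := gaussianPDFReal 0 1)
    (fun x _ => (hasDerivAt_gaussianPDFReal x).continuousAt.continuousWithinAt)
  have hC0 : 0 ≤ C := (norm_nonneg _).trans (hC 0 (by simp))
  have hφ : 0 < gaussianPDFReal 0 1 x₀ := gaussianPDFReal_pos _ _ _ one_ne_zero
  -- With C + 1 in place of C the inequality is strict and the denominator nonzero.
  refine ⟨gaussianPDFReal 0 1 x₀ / (C + 1), by positivity, fun x hx => ?_⟩
  have h1 : gaussianPDFReal 0 1 x₀ ≤ gaussianPDFReal 0 1 x := hx₀ hx
  have h2 : -C ≤ (legendreP m).eval x := (abs_le.1 (hC x hx)).1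
  have h4 : gaussianPDFReal 0 1 x₀ / (C + 1) * -C
      ≤ gaussianPDFReal 0 1 x₀ / (C + 1) * (legendreP m).eval x := by gcongr
  have h5 : gaussianPDFReal 0 1 x₀ / (C + 1) * C < gaussianPDFReal 0 1 x₀ := by
    rw [div_mul_eq_mul_div, div_lt_iff₀ (by positivity)]
    nlinarith
  linarith

lemma IsAdmissible.perturbedDensity_pos (h : IsAdmissible m ε) (x : ℝ) :
    0 < perturbedDensity m ε x := by
  unfold perturbedDensity
  by_cases hx : x ∈ Icc (0 : ℝ) 1
  · simpa [hx] using h.2 x hx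
  · simpa [hx] using gaussianPDFReal_pos 0 1 x one_ne_zero

lemma measurable_perturbedDensity : Measurable (perturbedDensity m ε) :=
  (measurable_gaussianPDFReal _ _).add
    (((legendreP m).continuous.measurable.indicator measurableSet_Icc).const_mul _)

lemma indicator_legendreP_mul_pow (j : ℕ) (x : ℝ) :
    (Icc (0 : ℝ) 1).indicator (fun y => (legendreP m).eval y) x * x ^ j
      = (Icc (0 : ℝ) 1).indicator (fun y => y ^ j * (legendreP m).eval y) x := by
  by_cases hx : x ∈ Icc (0 : ℝ) 1 <;> simp [hx, mul_comm]

lemma integrable_indicator_legendreP_mul_pow (j : ℕ) :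
    Integrable (fun x => (Icc (0 : ℝ) 1).indicator (fun y => (legendreP m).eval y) x * x ^ j) := by
  simp_rw [indicator_legendreP_mul_pow]
  rw [integrable_indicator_iff measurableSet_Icc]
  exact (((continuous_pow j).mul (legendreP m).continuous).continuousOn).integrableOn_Icc

lemma integrable_perturbedDensity_mul_pow (j : ℕ) :
    Integrable (fun x => perturbedDensity m ε x * x ^ j) := by
  simp_rw [perturbedDensity, add_mul, mul_assoc]
  exact (integrable_gaussianPDFReal_mul_pow j).add
    ((integrable_indicator_legendreP_mul_pow j).const_mul ε)

lemma integral_perturbedDensity_mul_pow (j : ℕ) :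
    ∫ x, perturbedDensity m ε x * x ^ j
      = ∫ x, x ^ j ∂(gaussianReal 0 1)
        + ε * ∫ x in (0 : ℝ)..1, x ^ j * (legendreP m).eval x := by
  simp_rw [perturbedDensity, add_mul, mul_assoc]
  rw [integral_add (integrable_gaussianPDFReal_mul_pow j)
    ((integrable_indicator_legendreP_mul_pow j).const_mul ε), integral_const_mul,
    integral_gaussianReal_eq_integral_smul one_ne_zero]
  simp_rw [indicator_legendreP_mul_pow, smul_eq_mul]
  rw [integral_indicator measurableSet_Icc, integral_Icc_eq_integral_Ioc,
    intervalIntegral.integral_of_le zero_le_one]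

lemma IsAdmissible.integral_pow (h : IsAdmissible m ε) (j : ℕ) :
    ∫ x, x ^ j ∂(perturbedNormal m ε)
      = ∫ x, x ^ j ∂(gaussianReal 0 1)
        + ε * ∫ x in (0 : ℝ)..1, x ^ j * (legendreP m).eval x := by
  rw [perturbedNormal, integral_withDensity_eq_integral_toReal_smul
    measurable_perturbedDensity.ennreal_ofReal (by simp), ← integral_perturbedDensity_mul_pow]
  simp [ENNReal.toReal_ofReal (h.perturbedDensity_pos _).le]

lemma IsAdmissible.integral_pow_of_lt (h : IsAdmissible m ε) {j : ℕ} (hj : j < m) :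
    ∫ x, x ^ j ∂(perturbedNormal m ε) = ∫ x, x ^ j ∂(gaussianReal 0 1) := by
  rw [h.integral_pow, integral_pow_mul_legendreP_of_lt hj, mul_zero, add_zero]

lemma IsAdmissible.integral_pow_self_ne (h : IsAdmissible m ε) :
    ∫ x, x ^ m ∂(perturbedNormal m ε) ≠ ∫ x, x ^ m ∂(gaussianReal 0 1) := by
  rw [h.integral_pow]
  simpa [h.1.ne'] using integral_pow_mul_legendreP_self_ne_zero m

lemma IsAdmissible.integrable_pow (h : IsAdmissible m ε) (j : ℕ) :
    Integrable (fun x : ℝ => x ^ j) (perturbedNormal m ε) := by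
  rw [perturbedNormal, integrable_withDensity_iff_integrable_smul'
    measurable_perturbedDensity.ennreal_ofReal (by simp)]
  simpa [ENNReal.toReal_ofReal (h.perturbedDensity_pos _).le]
    using integrable_perturbedDensity_mul_pow j

lemma IsAdmissible.isProbabilityMeasure (h : IsAdmissible m ε) (hm : 0 < m) :
    IsProbabilityMeasure (perturbedNormal m ε) := by
  have h1 : (perturbedNormal m ε).real univ = 1 := by simpa using h.integral_pow_of_lt hm
  refine ⟨?_⟩
  rw [measureReal_def] at h1
  exact (ENNReal.toReal_eq_one_iff _).1 h1

lemma IsAdmissible.pointsOfIncrease_eq_univ (h : IsAdmissible m ε) (hm : 0 < m) :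
    pointsOfIncrease (perturbedNormal m ε) = univ := by
  have := h.isProbabilityMeasure hm
  refine eq_univ_of_forall fun x δ hδ => ?_
  have hac : volume ≪ perturbedNormal m ε :=
    withDensity_absolutelyContinuous' measurable_perturbedDensity.ennreal_ofReal.aemeasurable
      (ae_of_all _ fun x => by simpa using h.perturbedDensity_pos x)
  rw [cdf_eq_real, cdf_eq_real, ← measureReal_sdiff (Iic_subset_Iic.2 (by linarith))
    measurableSet_Iic, Iic_sdiff_Iic, measureReal_def, ENNReal.toReal_pos_iff]
  refine ⟨pos_iff_ne_zero.2 fun h0 => ?_, measure_lt_top _ _⟩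
  have := hac h0
  rw [Real.volume_Ioc, ENNReal.ofReal_eq_zero] at this
  linarith

/-- Mean 0 and variance 1 leave only the standard normal law, whose m-th moment is different. -/
lemma IsAdmissible.ne_gaussianReal (h : IsAdmissible m ε) (hm : 2 < m) (a : ℝ) (v : NNReal) :
    perturbedNormal m ε ≠ gaussianReal a v := by
  intro heq
  have := h.isProbabilityMeasure (by lia)
  have h1 : ∫ x, x ∂(perturbedNormal m ε) = 0 := by
    have := h.integral_pow_of_lt (j := 1) (by lia)
    simpa using this
  have h2 : ∫ x, x ^ 2 ∂(perturbedNormal m ε) = 1 := by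
    have := integral_pow_succ_gaussianReal 1
    rw [h.integral_pow_of_lt hm]
    simpa using this
  have ha : a = 0 := by rw [heq] at h1; simpa using h1
  subst ha
  have hv : v = 1 := by
    have := variance_fun_id_gaussianReal (μ := 0) (v := v)
    rw [variance_eq_integral (by fun_prop)] at this
    rw [heq] at h2
    simp only [integral_id_gaussianReal, sub_zero] at this
    rw [h2] at this
    exact_mod_cast this.symm
  subst hv
  exact h.integral_pow_self_ne (by rw [heq])

lemma IsAdmissible.perturbedNormal_ne_of_lt {m' : ℕ} {ε' : ℝ} (h : IsAdmissible m ε)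
    (h' : IsAdmissible m' ε') (hmm : m < m') : perturbedNormal m ε ≠ perturbedNormal m' ε' := by
  intro heq
  exact h.integral_pow_self_ne (by rw [heq, h'.integral_pow_of_lt hmm])

lemma IsAdmissible.perturbedNormal_ne {m' : ℕ} {ε' : ℝ} (h : IsAdmissible m ε)
    (h' : IsAdmissible m' ε') (hmm : m ≠ m') : perturbedNormal m ε ≠ perturbedNormal m' ε' := by
  rcases hmm.lt_or_gt with hlt | hlt
  · exact h.perturbedNormal_ne_of_lt h' hlt
  · exact (h'.perturbedNormal_ne_of_lt h hlt).symm

end PerturbedNormal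

/-! ### The multivariate central limit theorem -/

section CentralLimit

variable {Ω ι : Type*} {mΩ : MeasurableSpace Ω} {P : Measure Ω} [IsProbabilityMeasure P]
  [Fintype ι]

lemma dotProduct_covariance_mulVec {Y : ι → Ω → ℝ} (hY : ∀ i, MemLp (Y i) 2 P) (x : ι → ℝ) :
    x ⬝ᵥ (Matrix.of fun i j => cov[Y i, Y j; P]).mulVec x = Var[fun ω => ∑ i, x i * Y i ω; P] := by
  rw [variance_fun_sum fun i => (hY i).const_mul (x i)]
  simp_rw [dotProduct, Matrix.mulVec, dotProduct, Finset.mul_sum, Matrix.of_apply,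
    covariance_const_mul_left, covariance_const_mul_right]
  refine Finset.sum_congr rfl fun i _ => Finset.sum_congr rfl fun j _ => ?_
  ring

lemma posSemidef_covariance {Y : ι → Ω → ℝ} (hY : ∀ i, MemLp (Y i) 2 P) :
    (Matrix.of fun i j => cov[Y i, Y j; P]).PosSemidef := by
  refine Matrix.PosSemidef.of_dotProduct_mulVec_nonneg ?_ fun x => ?_
  · ext i j
    simp [covariance_comm]
  · rw [star_trivial, dotProduct_covariance_mulVec hY]
    exact variance_nonneg _ _

variable [DecidableEq ι]

/-- The **multivariate central limit theorem**. -/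
theorem tendstoInDistribution_multivariateGaussian {Y : ℕ → Ω → EuclideanSpace ℝ ι}
    (hindep : iIndepFun Y P) (hident : ∀ n, IdentDistrib (Y n) (Y 0) P P)
    (hL2 : ∀ i, MemLp (fun ω => Y 0 ω i) 2 P) (hmean : ∀ i, ∫ ω, Y 0 ω i ∂P = 0) :
    TendstoInDistribution (fun (n : ℕ) ω => (√n)⁻¹ • ∑ l ∈ Finset.range n, Y l ω) atTop id
      (fun _ => P)
      (multivariateGaussian 0
        (Matrix.of fun i j => cov[fun ω => Y 0 ω i, fun ω => Y 0 ω j; P])) where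
  forall_aemeasurable n :=
    (Finset.aemeasurable_fun_sum _ fun _ _ => (hident _).aemeasurable_fst).const_smul (√n)⁻¹
  tendsto := by
    refine ProbabilityMeasure.tendsto_iff_tendsto_charFun.2 fun t => ?_
    have hmeas : Measurable fun y : EuclideanSpace ℝ ι => ∑ i, t i * y i := by fun_prop
    -- Cramér–Wold: the characteristic function of the vector at t is that of its projection on t at
    -- 1, so the one-dimensional CLT suffices.
    set Z : ℕ → Ω → ℝ := fun n ω => ∑ i, t i * Y n ω i with hZ
    have hZL2 : MemLp (Z 0) 2 P := memLp_finsetSum _ fun i _ => (hL2 i).const_mul (t i)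
    have hZmean : P[Z 0] = 0 := by
      simp only [hZ]
      rw [integral_finsetSum _ fun i _ => ((hL2 i).integrable one_le_two).const_mul (t i)]
      simp [integral_const_mul, hmean]
    have hclt := tendstoInDistribution_inv_sqrt_mul_sum_sub (P := P) (X := Z)
      (Y := id) (P' := gaussianReal 0 Var[Z 0; P].toNNReal) .id hZL2
      (hindep.comp (fun _ y => ∑ i, t i * y i) fun _ => hmeas)
      fun n => (hident n).comp hmeas
    simp only [hZmean, mul_zero, sub_zero] at hclt
    have h1 := ProbabilityMeasure.tendsto_iff_tendsto_charFun.1 hclt.tendsto 1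
    have hmeasS : ∀ n : ℕ, AEMeasurable (fun ω => (√n)⁻¹ • ∑ l ∈ Finset.range n, Y l ω) P :=
      fun n => (Finset.aemeasurable_fun_sum _ fun _ _ => (hident _).aemeasurable_fst).const_smul
        (√n)⁻¹
    have hmeasZ := hclt.forall_aemeasurable
    simp only [ProbabilityMeasure.coe_mk] at h1 ⊢
    convert! h1 using 2
    · rename_i n
      rw [charFun_apply, charFun_apply, integral_map (hmeasS n) (by fun_prop),
        integral_map (hmeasZ n) (by fun_prop)]
      congr 1
      ext ω
      have hω : inner ℝ ((√n)⁻¹ • ∑ l ∈ Finset.range n, Y l ω) t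
          = inner ℝ ((√n)⁻¹ * ∑ l ∈ Finset.range n, Z l ω) 1 := by
        simp only [hZ, PiLp.inner_apply, PiLp.smul_apply, WithLp.ofLp_sum, Finset.sum_apply,
          smul_eq_mul, RCLike.inner_apply, conj_trivial, one_mul, Finset.mul_sum]
        rw [Finset.sum_comm]
        exact Finset.sum_congr rfl fun l _ => Finset.sum_congr rfl fun i _ => by ring
      rw [hω]
    · rw [Measure.map_id, Measure.map_id, charFun_multivariateGaussian (posSemidef_covariance hL2),
        dotProduct_covariance_mulVec hL2, charFun_gaussianReal]
      simp [Real.coe_toNNReal _ (variance_nonneg _ _), hZ]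

end CentralLimit

/-! ### Asymptotic independence from a moment recursion -/

section AsymptoticIndependence

/-- One factor a is pulled out so that, for a = X̄_n, it can absorb the √n while its cofactor
converges. -/
lemma sum_pow_sub_eq {n : ℕ} (x : ℕ → ℝ) (a : ℝ) (j : ℕ) :
    (1 / (n : ℝ)) * ∑ i ∈ Finset.range n, (x i - a) ^ j
      = (1 / (n : ℝ)) * ∑ i ∈ Finset.range n, x i ^ j
        + a * ∑ r ∈ Finset.range j, (j.choose (r + 1) : ℝ) * (-1) ^ (r + 1) * a ^ r *
          ((1 / (n : ℝ)) * ∑ i ∈ Finset.range n, x i ^ (j - (r + 1))) := by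
  simp_rw [Finset.mul_sum]
  rw [Finset.sum_comm, ← Finset.sum_add_distrib]
  refine Finset.sum_congr rfl fun i _ => ?_
  rw [sub_eq_neg_add, add_pow, Finset.sum_range_succ', mul_add, add_comm, Finset.mul_sum]
  congr 1
  · simp
  · refine Finset.sum_congr rfl fun r _ => ?_
    rw [neg_pow]
    ring

variable {F : Measure ℝ} {Ω : Type u} {mΩ : MeasurableSpace Ω} {P : Measure Ω}
  {X : ℕ → Ω → ℝ}

/-- The exponent attached to a coordinate of the vector of raw moments. -/
def exponent (k : ℕ) : Option (Finset.Icc 2 k) → ℕ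
  | none => 1
  | some j => j

/-- The factor with which `√n X̄_n` enters the `j`-th scaled sample central moment. -/
noncomputable def remainder (X : ℕ → Ω → ℝ) (j n : ℕ) (ω : Ω) : ℝ :=
  ∑ r ∈ Finset.range j, (j.choose (r + 1) : ℝ) * (-1) ^ (r + 1) * sampleMean X n ω ^ r *
    ((1 / (n : ℝ)) * ∑ i ∈ Finset.range n, X i ω ^ (j - (r + 1)))

lemma memLp_comp_of_hasLaw {Z : Ω → ℝ} (hZ : HasLaw Z F P) {f : ℝ → ℝ} {p : ENNReal}
    (hf : MemLp f p F) : MemLp (fun ω => f (Z ω)) p P := by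
  rw [← hZ.map_eq] at hf
  exact hf.comp_of_map hZ.aemeasurable

lemma ae_tendsto_sample_moment (hX : iIndepFun X P) (hlaw : ∀ i, HasLaw (X i) F P)
    (hint : ∀ j : ℕ, Integrable (fun x : ℝ => x ^ j) F) (j : ℕ) :
    ∀ᵐ ω ∂P, Tendsto (fun n : ℕ => (1 / (n : ℝ)) * ∑ i ∈ Finset.range n, X i ω ^ j) atTop
      (𝓝 (∫ x, x ^ j ∂F)) := by
  have h0 : Integrable (fun ω => X 0 ω ^ j) P := by
    exact memLp_one_iff_integrable.1
      (memLp_comp_of_hasLaw (hlaw 0) (memLp_one_iff_integrable.2 (hint j)))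
  have h := strong_law_ae_real (μ := P) (fun i ω => X i ω ^ j) h0
    (fun a b hab => (hX.indepFun hab).comp (measurable_id.pow_const j) (measurable_id.pow_const j))
    (fun i => ((hlaw i).identDistrib (hlaw 0)).comp (measurable_id.pow_const j))
  have h1 : ∫ ω, X 0 ω ^ j ∂P = ∫ x, x ^ j ∂F := by
    rw [← (hlaw 0).map_eq, integral_map (hlaw 0).aemeasurable (by fun_prop)]
  filter_upwards [h] with ω hω
  rw [h1] at hω
  refine hω.congr fun n => ?_
  rw [one_div, inv_mul_eq_div]

lemma ae_tendsto_remainder (hX : iIndepFun X P) (hlaw : ∀ i, HasLaw (X i) F P)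
    (hint : ∀ j : ℕ, Integrable (fun x : ℝ => x ^ j) F) (hmean : ∫ x, x ∂F = 0) {j : ℕ}
    (hj : 1 ≤ j) :
    ∀ᵐ ω ∂P, Tendsto (fun n => remainder X j n ω) atTop (𝓝 (-(j * ∫ x, x ^ (j - 1) ∂F))) := by
  have h := ae_all_iff.2 (ae_tendsto_sample_moment hX hlaw hint)
  filter_upwards [h] with ω hω
  have h1 : Tendsto (fun n => sampleMean X n ω) atTop (𝓝 0) := by
    simpa [sampleMean, hmean] using hω 1
  have h2 : -(j * ∫ x, x ^ (j - 1) ∂F) = ∑ r ∈ Finset.range j,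
      (j.choose (r + 1) : ℝ) * (-1) ^ (r + 1) * 0 ^ r * ∫ x, x ^ (j - (r + 1)) ∂F := by
    -- As X̄_n → 0, only the term r = 0 survives.
    rw [Finset.sum_eq_single_of_mem 0 (Finset.mem_range.2 hj) fun r _ hr => by simp [hr]]
    simp
  rw [h2]
  exact tendsto_finsetSum _ fun r _ => ((h1.pow r).const_mul _).mul (hω _)

lemma scaledDeviation_eq (F : Measure ℝ) (hmean : ∫ x, x ∂F = 0) (X : ℕ → Ω → ℝ) (k n : ℕ)
    (ω : Ω) (S : Option (Finset.Icc 2 k) → ℝ)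
    (hS : ∀ s, S s = (√n)⁻¹ * ∑ l ∈ Finset.range n,
      (X l ω ^ exponent k s - ∫ x, x ^ exponent k s ∂F)) :
    scaledDeviation F X k n ω
      = (S none, fun j => S (some j) + S none * remainder X j n ω) := by
  have hsum : ∀ s, S s = √n * ((1 / (n : ℝ)) * ∑ l ∈ Finset.range n, X l ω ^ exponent k s
      - ∫ x, x ^ exponent k s ∂F) := by
    intro s
    rcases n.eq_zero_or_pos with rfl | hn
    · simp [hS]
    · have hn' : (0 : ℝ) < n := by exact_mod_cast hn
      have h1 : √(n : ℝ) * √(n : ℝ) = n := Real.mul_self_sqrt hn'.le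
      have h2 : √(n : ℝ) ≠ 0 := (Real.sqrt_pos.2 hn').ne'
      rw [hS, Finset.sum_sub_distrib, Finset.sum_const, Finset.card_range, nsmul_eq_mul]
      field_simp
      rw [pow_two, h1]
  have hnone : S none = √n * sampleMean X n ω := by
    rw [hsum]
    simp [exponent, sampleMean, hmean]
  unfold scaledDeviation
  ext j
  · simp [hnone, hmean]
  · simp only [hnone, hsum (some j), exponent, sampleCentralMoment, remainder, centralMoment,
      hmean, sum_pow_sub_eq]
    simp
    ring

lemma indepFun_of_covariance_eq_zero {k : ℕ} {S : Matrix (Option (Finset.Icc 2 k))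
    (Option (Finset.Icc 2 k)) ℝ} (hS : S.PosSemidef) (c : Finset.Icc 2 k → ℝ)
    (hc : ∀ j, S none (some j) + S none none * c j = 0) :
    IndepFun (fun z : EuclideanSpace ℝ (Option (Finset.Icc 2 k)) => z none)
      (fun z (j : Finset.Icc 2 k) => z (some j) + z none * c j) (multivariateGaussian 0 S) := by
  have hL2 : ∀ s, MemLp (fun z : EuclideanSpace ℝ (Option (Finset.Icc 2 k)) => z s) 2
      (multivariateGaussian 0 S) := fun s =>
    (IsGaussian.hasGaussianLaw_id.map_fun (EuclideanSpace.proj s)).memLp_two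
  -- A linear image of a Gaussian vector is Gaussian. The first component is indexed by `Unit`
  -- because the covariance criterion compares two families.
  let L : EuclideanSpace ℝ (Option (Finset.Icc 2 k)) →L[ℝ] (Unit → ℝ) × (Finset.Icc 2 k → ℝ) :=
    (ContinuousLinearMap.pi fun _ => EuclideanSpace.proj none).prod
      (ContinuousLinearMap.pi fun j =>
        EuclideanSpace.proj (some j) + c j • EuclideanSpace.proj none)
  have hL : HasGaussianLaw (fun z : EuclideanSpace ℝ (Option (Finset.Icc 2 k)) =>
      ((fun _ : Unit => z none), (fun j => z (some j) + z none * c j)))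
      (multivariateGaussian 0 S) := by
    convert! (IsGaussian.hasGaussianLaw_id (μ := multivariateGaussian 0 S)).map_fun L using 2
    ext j
    · simp [L]
    · simp [L, mul_comm]
  have h := hL.indepFun_of_covariance_eval
    (X := fun _ (z : EuclideanSpace ℝ (Option (Finset.Icc 2 k))) => z none)
    (Y := fun j z => z (some j) + z none * c j) fun _ j => ?_
  · exact h.comp (φ := fun x : Unit → ℝ => x ()) (ψ := id) (by fun_prop) measurable_id
  · refine (covariance_add_right (hL2 none) (hL2 (some j)) ((hL2 none).mul_const (c j))).trans ?_
    rw [covariance_mul_const_right, covariance_eval_multivariateGaussian hS,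
      covariance_eval_multivariateGaussian hS, hc]

theorem isAsymptoticallyIndependent_of_moments {k : ℕ} [IsProbabilityMeasure F]
    (hint : ∀ j : ℕ, Integrable (fun x : ℝ => x ^ j) F) (hmean : ∫ x, x ∂F = 0)
    (hmom : ∀ j ∈ Finset.Icc 2 k,
      ∫ x, x ^ (j + 1) ∂F = j * (∫ x, x ^ (j - 1) ∂F) * ∫ x, x ^ 2 ∂F) :
    IsAsymptoticallyIndependent.{u} F k := by
  intro Ω _ P _ X hX hlaw
  let ψ : ℝ → EuclideanSpace ℝ (Option (Finset.Icc 2 k)) := fun x =>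
    WithLp.toLp 2 fun s => x ^ exponent k s - ∫ y, y ^ exponent k s ∂F
  have hψ : Measurable ψ := by fun_prop
  let Y : ℕ → Ω → EuclideanSpace ℝ (Option (Finset.Icc 2 k)) := fun n ω => ψ (X n ω)
  have hpow : ∀ j, MemLp (fun x : ℝ => x ^ j) 2 F := fun j => by
    rw [memLp_two_iff_integrable_sq (by fun_prop)]
    simpa [← pow_mul] using hint (j * 2)
  have hYF : ∀ s, MemLp (fun x : ℝ => x ^ exponent k s - ∫ y, y ^ exponent k s ∂F) 2 F :=
    fun s => (hpow _).sub (memLp_const _)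
  have hL2 : ∀ s, MemLp (fun ω => Y 0 ω s) 2 P := fun s => by
    exact memLp_comp_of_hasLaw (hlaw 0) (hYF s)
  have hmeanY : ∀ s, ∫ ω, Y 0 ω s ∂P = 0 := fun s => by
    refine ((hlaw 0).integral_comp (f := fun x : ℝ => x ^ exponent k s -
      ∫ y, y ^ exponent k s ∂F) (by fun_prop)).trans ?_
    rw [integral_sub (hint _) (integrable_const _)]
    simp
  have hclt := tendstoInDistribution_multivariateGaussian (Y := Y)
    (hX.comp (fun _ => ψ) fun _ => hψ)
    (fun n => ((hlaw n).identDistrib (hlaw 0)).comp hψ) hL2 hmeanY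
  set S : Matrix (Option (Finset.Icc 2 k)) (Option (Finset.Icc 2 k)) ℝ :=
    Matrix.of fun i j => cov[fun ω => Y 0 ω i, fun ω => Y 0 ω j; P] with hSdef
  have hS : S.PosSemidef := posSemidef_covariance hL2
  have hSval : ∀ s, S none s = ∫ x, x ^ (exponent k s + 1) ∂F := fun s => by
    refine ((hlaw 0).covariance_fun_comp (f := fun x : ℝ => x ^ exponent k none -
      ∫ y, y ^ exponent k none ∂F) (g := fun x : ℝ => x ^ exponent k s -
      ∫ y, y ^ exponent k s ∂F) (by fun_prop) (by fun_prop)).trans ?_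
    rw [covariance_sub_const_left (hint _), covariance_sub_const_right (hint _),
      covariance_eq_sub (hpow _) (hpow _)]
    simp [exponent, hmean, pow_succ']
  let c : Finset.Icc 2 k → ℝ := fun j => -((j : ℕ) * ∫ x, x ^ ((j : ℕ) - 1) ∂F)
  have hXmeas : ∀ i, AEMeasurable (X i) P := fun i => (hlaw i).aemeasurable
  have hrem_meas : ∀ n, AEMeasurable (fun ω => fun j : Finset.Icc 2 k => remainder X j n ω) P := by
    intro n
    refine aemeasurable_pi_lambda _ fun j => ?_
    unfold remainder sampleMean
    fun_prop
  have hrem : TendstoInMeasure P (fun n ω => fun j : Finset.Icc 2 k => remainder X j n ω) atTop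
      (fun _ => c) := by
    refine tendstoInMeasure_of_tendsto_ae (fun n => (hrem_meas n).aestronglyMeasurable) ?_
    have h : ∀ j : Finset.Icc 2 k, ∀ᵐ ω ∂P,
        Tendsto (fun n => remainder X j n ω) atTop (𝓝 (c j)) := fun j =>
      ae_tendsto_remainder hX hlaw hint hmean (by have := (Finset.mem_Icc.1 j.2).1; lia)
    filter_upwards [ae_all_iff.2 h] with ω hω
    exact tendsto_pi_nhds.2 hω
  -- Slutsky's theorem, with the constant limit `c` of the remainders.
  have hlim := hclt.continuous_comp_prodMk_of_tendstoInMeasure_const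
    (g := fun p : EuclideanSpace ℝ (Option (Finset.Icc 2 k)) × (Finset.Icc 2 k → ℝ) =>
      (p.1 none, fun j => p.1 (some j) + p.1 none * p.2 j)) (by fun_prop) hrem hrem_meas
  refine ⟨EuclideanSpace ℝ (Option (Finset.Icc 2 k)), inferInstance, multivariateGaussian 0 S,
    inferInstance, fun z => z none, fun z j => z (some j) + z none * c j,
    indepFun_of_covariance_eq_zero hS c fun j => ?_, ?_⟩
  · rw [hSval, hSval]
    simp only [exponent, c]
    rw [hmom j j.2]
    ring
  · convert! hlim using 3 with n ω
    refine scaledDeviation_eq F hmean X k n ω _ fun s => ?_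
    simp [Y, ψ]

end AsymptoticIndependence

lemma IsAdmissible.isNonNormalWithAsymptoticIndependence {k m : ℕ} {ε : ℝ} (hk : 2 ≤ k)
    (hm : k + 2 ≤ m) (h : IsAdmissible m ε) :
    IsNonNormalWithAsymptoticIndependence.{u} k (perturbedNormal m ε) := by
  have hprob := h.isProbabilityMeasure (by lia)
  refine ⟨hprob, ?_, h.ne_gaussianReal (by lia), fun j => ?_, ?_⟩
  · rw [h.pointsOfIncrease_eq_univ (by lia)]
    exact nontrivial_univ
  · simpa using (h.integrable_pow j).abs
  · refine isAsymptoticallyIndependent_of_moments h.integrable_pow ?_ fun j hj => ?_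
    · simpa using h.integral_pow_of_lt (j := 1) (by lia)
    · have := Finset.mem_Icc.1 hj
      have h2 := integral_pow_succ_gaussianReal 1
      -- The largest order used is j + 1 ≤ k + 1, hence the condition m ≥ k + 2.
      rw [h.integral_pow_of_lt (by lia), h.integral_pow_of_lt (by lia),
        h.integral_pow_of_lt (by lia), integral_pow_succ_gaussianReal j]
      simp at h2
      simp [h2]

end SampleMoments

theorem mainTheorem6 (k : ℕ) (hk : 2 ≤ k) :
    {F : Measure ℝ | SampleMoments.IsNonNormalWithAsymptoticIndependence.{u} k F}.Infinite ∧
    (∀ m : ℕ, k + 2 ≤ m → ∃ ε : ℝ, SampleMoments.IsAdmissible m ε) ∧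
    (∀ (m : ℕ) (ε : ℝ), k + 2 ≤ m → SampleMoments.IsAdmissible m ε →
      SampleMoments.IsNonNormalWithAsymptoticIndependence.{u} k
        (SampleMoments.perturbedNormal m ε)) ∧
    (∀ (m m' : ℕ) (ε ε' : ℝ), k + 2 ≤ m → k + 2 ≤ m' → m ≠ m' →
      SampleMoments.IsAdmissible m ε → SampleMoments.IsAdmissible m' ε' →
      SampleMoments.perturbedNormal m ε ≠ SampleMoments.perturbedNormal m' ε') := by
  refine ⟨?_, fun m _ => SampleMoments.exists_isAdmissible m,
    fun m ε hm h => h.isNonNormalWithAsymptoticIndependence hk hm,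
    fun m m' ε ε' _ _ hne h h' => h.perturbedNormal_ne h' hne⟩
  choose ε hε using SampleMoments.exists_isAdmissible
  refine Set.infinite_of_injective_forall_mem
    (f := fun i : ℕ => SampleMoments.perturbedNormal (k + 2 + i) (ε (k + 2 + i)))
    (fun i j hij => ?_)
    fun i => (hε _).isNonNormalWithAsymptoticIndependence hk (by lia)
  by_contra hne
  exact (hε _).perturbedNormal_ne (hε _) (by lia) hij
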